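/- There are eleven mosaic tiles $T_0,\dots,T_{10}$, with the following connection points, where $l,r,t,b$ stand for the midpoints of the left, right, top and bottom edge: $T_0$ has none; $T_1,T_2,T_3,T_4,T_5,T_6$ have exactly $\{l,b\},\{r,b\},\{t,r\},\{t,l\},\{l,r\},\{t,b\}$, respectively; each of $T_7,T_8,T_9,T_{10}$ has all four. A period knot $(m,n)$-mosaic is an $m\times n$ matrix of mosaic tiles such that any two tiles adjacent in a row or a column both have or both lack a connection point on their common edge, and such that the two tiles at the opposite ends of any row or column both have or both lack a connection point on their edges at the boundary of the mosaic. Let $D_P^{(m,n)}$ be the number of period knot $(m,n)$-mosaics. Two of them are equivalent if one is obtained from the other by cyclic rotations of the rows and of the columns (that is, $M'_{i,j}=M_{i-x,j-y}$ for some $x,y$, with indices modulo $m$ and $n$). A toroidal knot $(m,n)$-mosaic is an equivalence class, and $D_T^{(m,n)}$ is the number of toroidal knot $(m,n)$-mosaics. Define $2^k\times 2^k$ matrices by $X_0^+=O_0^+=[1]$, $X_0^-=O_0^-=[0]$ and $$X_{k+1}^+=\begin{bmatrix}X_k^+&O_k^-\\O_k^-&X_k^+\end{bmatrix},\quad X_{k+1}^-=\begin{bmatrix}X_k^-&O_k^+\\O_k^+&X_k^-\end{bmatrix},\quad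 O_{k+1}^+=\begin{bmatrix}O_k^+&X_k^-\\X_k^-&4\,O_k^+\end{bmatrix},\quad O_{k+1}^-=\begin{bmatrix}O_k^-&X_k^+\\X_k^+&4\,O_k^-\end{bmatrix}.$$ For a $2^p\times 2^p$ matrix $A$ let $\mathrm{tr}^{(k)}(A)=\sum_{i=0}^{2^p-1}A_{i+1,\,\alpha(i)+1}$, where $\alpha(i)$ is the remainder of $2^k i$ on division by $2^p-1$ for $0\le i<2^p-1$, and $\alpha(2^p-1)=2^p-1$; in particular $\mathrm{tr}^{(0)}=\mathrm{tr}$. Theorem. $D_T^{(2,2)}=110$. For every prime $p\ge 3$, put $$d_{p_{(k,1)}}=\mathrm{tr}^{(k)}(X_p^++O_p^+)-7\quad\Bigl(0\le k\le\tfrac{p-1}{2}\Bigr),\qquad d_{p^2}=D_P^{(p,p)}-2\sum_{k=0}^{\frac{p-1}{2}}d_{p_{(k,1)}}-7.$$ These integers are positive, and $$D_T^{(p,p)}=\frac{1}{p^2}\,d_{p^2}+\frac{2}{p}\sum_{k=0}^{\frac{p-1}{2}}d_{p_{(k,1)}}+7.$$ -/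

import Mathlib

namespace KnotMosaic

/-- The eleven mosaic tiles: `T0` is blank, `T1`, ..., `T4` carry a single quarter arc, `T5` a
horizontal segment, `T6` a vertical segment, `T7`, `T8` two quarter arcs, `T9`, `T10` a crossing. -/
inductive Tile : Type
  | T0 | T1 | T2 | T3 | T4 | T5 | T6 | T7 | T8 | T9 | T10
  deriving DecidableEq

namespace Tile

instance : Fintype Tile where
  elems := {T0, T1, T2, T3, T4, T5, T6, T7, T8, T9, T10}
  complete := by intro t; cases t <;> decide

/-- The tile has a connection point on its left edge. -/
def left : Tile → Bool
  | T0 | T2 | T3 | T6 => false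
  | T1 | T4 | T5 | T7 | T8 | T9 | T10 => true

/-- The tile has a connection point on its right edge. -/
def right : Tile → Bool
  | T0 | T1 | T4 | T6 => false
  | T2 | T3 | T5 | T7 | T8 | T9 | T10 => true

/-- The tile has a connection point on its top edge. -/
def top : Tile → Bool
  | T0 | T1 | T2 | T5 => false
  | T3 | T4 | T6 | T7 | T8 | T9 | T10 => true

/-- The tile has a connection point on its bottom edge. -/
def bottom : Tile → Bool
  | T0 | T3 | T4 | T5 => false
  | T1 | T2 | T6 | T7 | T8 | T9 | T10 => true

end Tile

/-- An `(m, n)`-mosaic is an `m × n` matrix of mosaic tiles; row `0` is the top row and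
column `0` the leftmost column. -/
abbrev Mosaic (m n : ℕ) : Type := Matrix (Fin m) (Fin n) Tile

/-- Contiguous tiles both have or both lack a connection point on their common edge. -/
def SuitablyConnected {m n : ℕ} (M : Mosaic m n) : Prop :=
  (∀ (i : Fin m) (j j' : Fin n), (j : ℕ) + 1 = j' → (M i j).right = (M i j').left) ∧
  (∀ (i i' : Fin m) (j : Fin n), (i : ℕ) + 1 = i' → (M i j).bottom = (M i' j).top)

/-- Tiles at the opposite ends of a row or of a column both have or both lack a connection point
on their edges at the boundary of the mosaic. -/
def SuitablyBoundaryConnected {m n : ℕ} (M : Mosaic m n) : Prop :=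
  (∀ (i : Fin m) (j j' : Fin n), (j : ℕ) + 1 = n → (j' : ℕ) = 0 →
    (M i j).right = (M i j').left) ∧
  (∀ (i i' : Fin m) (j : Fin n), (i : ℕ) + 1 = m → (i' : ℕ) = 0 →
    (M i j).bottom = (M i' j).top)

/-- The period knot `(m, n)`-mosaics. -/
def PeriodMosaic (m n : ℕ) : Type :=
  {M : Mosaic m n // SuitablyConnected M ∧ SuitablyBoundaryConnected M}

/-- `D_P^{(m, n)}`, the number of period knot `(m, n)`-mosaics. -/
noncomputable def DP (m n : ℕ) : ℕ := Nat.card (PeriodMosaic m n)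

/-- The cyclic rotation by `x` rows and `y` columns; subtraction of indices is cyclic. -/
def rotate {m n : ℕ} [NeZero m] [NeZero n] (x : Fin m) (y : Fin n) (M : Mosaic m n) :
    Mosaic m n :=
  fun i j => M (i - x) (j - y)

/-- Two period knot mosaics are equivalent if one is a cyclic rotation of the other. -/
instance toroidalSetoid (m n : ℕ) [NeZero m] [NeZero n] : Setoid (PeriodMosaic m n) where
  r M N := ∃ (x : Fin m) (y : Fin n), N.1 = rotate x y M.1
  iseqv :=
    { refl := fun M => ⟨0, 0, by funext i j; simp [rotate]⟩
      symm := by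
        rintro M N ⟨x, y, h⟩
        refine ⟨-x, -y, ?_⟩
        rw [h]
        funext i j
        simp [rotate]
      trans := by
        rintro M N P ⟨x, y, h⟩ ⟨x', y', h'⟩
        refine ⟨x' + x, y' + y, ?_⟩
        rw [h', h]
        funext i j
        simp [rotate, sub_sub] }

/-- The toroidal knot `(m, n)`-mosaics. -/
def ToroidalMosaic (m n : ℕ) [NeZero m] [NeZero n] : Type := Quotient (toroidalSetoid m n)

/-- `D_T^{(m, n)}`, the number of toroidal knot `(m, n)`-mosaics. -/
noncomputable def DT (m n : ℕ) [NeZero m] [NeZero n] : ℕ := Nat.card (ToroidalMosaic m n)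

/-- `{0, ..., 2^k - 1}` followed by a second copy of it, identified with `{0, ..., 2^(k+1) - 1}`. -/
def halves (k : ℕ) : Fin (2 ^ k) ⊕ Fin (2 ^ k) ≃ Fin (2 ^ (k + 1)) :=
  finSumFinEquiv.trans (finCongr (by rw [pow_succ, mul_two]))

/-- The `2^(k+1) × 2^(k+1)` matrix with the four given `2^k × 2^k` quadrants, in the order
upper left, upper right, lower left, lower right. -/
def blocks {k : ℕ} (A B C D : Matrix (Fin (2 ^ k)) (Fin (2 ^ k)) ℤ) :
    Matrix (Fin (2 ^ (k + 1))) (Fin (2 ^ (k + 1))) ℤ :=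
  Matrix.reindex (halves k) (halves k) (Matrix.fromBlocks A B C D)

mutual

/-- The matrix `X_k^+`. -/
def Xplus : (k : ℕ) → Matrix (Fin (2 ^ k)) (Fin (2 ^ k)) ℤ
  | 0 => Matrix.of fun _ _ => 1
  | k + 1 => blocks (Xplus k) (Ominus k) (Ominus k) (Xplus k)

/-- The matrix `X_k^-`. -/
def Xminus : (k : ℕ) → Matrix (Fin (2 ^ k)) (Fin (2 ^ k)) ℤ
  | 0 => Matrix.of fun _ _ => 0
  | k + 1 => blocks (Xminus k) (Oplus k) (Oplus k) (Xminus k)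

/-- The matrix `O_k^+`. -/
def Oplus : (k : ℕ) → Matrix (Fin (2 ^ k)) (Fin (2 ^ k)) ℤ
  | 0 => Matrix.of fun _ _ => 1
  | k + 1 => blocks (Oplus k) (Xminus k) (Xminus k) ((4 : ℤ) • Oplus k)

/-- The matrix `O_k^-`. -/
def Ominus : (k : ℕ) → Matrix (Fin (2 ^ k)) (Fin (2 ^ k)) ℤ
  | 0 => Matrix.of fun _ _ => 0
  | k + 1 => blocks (Ominus k) (Xplus k) (Xplus k) ((4 : ℤ) • Ominus k)

end

/-- `α(i) = 2^k i (mod 2^p - 1)` on `{0, ..., 2^p - 1}`. The residue class of `0` has the two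
representatives `0` and `2^p - 1` in this range; each of them is sent to itself, so that `α` is
the cyclic shift of the `p` binary digits by `k` places, and the identity for `k = 0`. -/
def alpha (p k : ℕ) (i : Fin (2 ^ p)) : Fin (2 ^ p) :=
  if h : (i : ℕ) = 2 ^ p - 1 then i
  else ⟨(2 ^ k * (i : ℕ)) % (2 ^ p - 1),
    (Nat.mod_lt _ (by have := i.isLt; omega)).trans_le (Nat.sub_le _ _)⟩

/-- The twisted trace `tr^{(k)}` of a `2^p × 2^p` matrix (indices start at `0`). -/
def twistedTrace {p : ℕ} (k : ℕ) (A : Matrix (Fin (2 ^ p)) (Fin (2 ^ p)) ℤ) : ℤ :=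
  ∑ i : Fin (2 ^ p), A i (alpha p k i)

/-- `d_{p_(k,1)}`. -/
def dTwisted (p k : ℕ) : ℤ := twistedTrace k (Xplus p + Oplus p) - 7

/-- `d_{p²}`; the sum runs over `k = 0, ..., (p - 1) / 2`. -/
noncomputable def dSquare (p : ℕ) : ℤ :=
  (DP p p : ℤ) - 2 * ∑ k ∈ Finset.range ((p - 1) / 2 + 1), dTwisted p k - 7

end KnotMosaic

-- Period mosaics are tilings of the torus `ℤ/p × ℤ/p`, and toroidal mosaics are their orbits under
-- translation, so Burnside's lemma counts them (`sum_card_fixedBy`). The identity fixes all `D_P`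
-- mosaics. For `p` prime, a nonzero translation has the same fixed mosaics as one of the `p + 1`
-- directions `(k, 1)` and `(1, 0)`, each having `p - 1` nonzero multiples. A mosaic fixed by `(k,
-- 1)` is one column whose right edges match its own left edges shifted by `k`;
-- `twistedTrace_eq_card` counts these, `N_k` in number, since the state matrices count columns by
-- edge states and `alpha` shifts binary digits. Mirroring gives `N_{-k} = N_k`, and transposing
-- gives `N_0` for `(1, 0)`. Hence each `k ≤ (p - 1) / 2` occurs twice, and `DT_mul_sq` becomes the
-- formula. The subtracted 7 counts constant mosaics, the only ones fixed in two directions;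
-- positivity needs one further mosaic of each type.

namespace KnotMosaic

-- State matrices as counts of columns

/-- The state matrix of a column of `n` tiles whose last bottom edge and first top edge carry
connection points as prescribed by `b` and `b'`. -/
def stateMatrix (n : ℕ) : Bool → Bool → Matrix (Fin (2 ^ n)) (Fin (2 ^ n)) ℤ
  | false, false => Xplus n
  | false, true => Xminus n
  | true, true => Oplus n
  | true, false => Ominus n

/-- Contiguous tiles of the column `c` match, its last bottom edge is in state `b` and its first
top edge in state `b'`. -/
def IsChain : (n : ℕ) → Bool → Bool → (Fin n → Tile) → Prop
  | 0, b, b', _ => b = b'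
  | n + 1, b, b', c =>
    (c (Fin.last n)).bottom = b ∧ IsChain n (c (Fin.last n)).top b' fun i => c i.castSucc

theorem isChain_succ_iff {n : ℕ} {b b' : Bool} {c : Fin (n + 1) → Tile} :
    IsChain (n + 1) b b' c ↔ (c (Fin.last n)).bottom = b ∧ (c 0).top = b' ∧
      ∀ i : Fin n, (c i.castSucc).bottom = (c i.succ).top := by
  induction n generalizing b with
  | zero => simp [IsChain]
  | succ n ih =>
    rw [IsChain, ih]
    constructor
    · rintro ⟨h1, h2, h3, h4⟩
      refine ⟨h1, h3, fun i => ?_⟩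
      induction i using Fin.lastCases with
      | last => exact h2
      | cast i => exact h4 i
    · rintro ⟨h1, h2, h3⟩
      exact ⟨h1, h3 (Fin.last n), h2, fun i => h3 i.castSucc⟩

theorem coe_halves_inl {n : ℕ} (i : Fin (2 ^ n)) : (halves n (Sum.inl i) : ℕ) = i := by
  simp [halves]

theorem coe_halves_inr {n : ℕ} (i : Fin (2 ^ n)) : (halves n (Sum.inr i) : ℕ) = 2 ^ n + i := by
  simp [halves, add_comm]

/-- Prepending the most significant digit `x` to an `n`-digit number. -/
def prependBit {n : ℕ} (x : Bool) (i : Fin (2 ^ n)) : Fin (2 ^ (n + 1)) :=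
  halves n (cond x (Sum.inr i) (Sum.inl i))

theorem exists_prependBit {n : ℕ} (i : Fin (2 ^ (n + 1))) :
    ∃ (x : Bool) (i' : Fin (2 ^ n)), i = prependBit x i' := by
  obtain ⟨s, rfl⟩ := (halves n).surjective i
  rcases s with i' | i'
  · exact ⟨false, i', rfl⟩
  · exact ⟨true, i', rfl⟩

theorem testBit_prependBit_last {n : ℕ} (x : Bool) (i : Fin (2 ^ n)) :
    (prependBit x i : ℕ).testBit n = x := by
  cases x
  · simp [prependBit, coe_halves_inl, Nat.testBit_lt_two_pow i.isLt]
  · simp [prependBit, coe_halves_inr, Nat.testBit_two_pow_add_eq, Nat.testBit_lt_two_pow i.isLt]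

theorem testBit_prependBit_of_lt {n r : ℕ} (hr : r < n) (x : Bool) (i : Fin (2 ^ n)) :
    (prependBit x i : ℕ).testBit r = (i : ℕ).testBit r := by
  cases x
  · simp [prependBit, coe_halves_inl]
  · simp [prependBit, coe_halves_inr, Nat.testBit_two_pow_add_gt hr]

theorem sum_tile {R : Type*} [AddCommMonoid R] (f : Tile → R) :
    ∑ t, f t = f .T0 + (f .T1 + (f .T2 + (f .T3 + (f .T4 + (f .T5 + (f .T6 + (f .T7 + (f .T8 +
      (f .T9 + f .T10))))))))) := by
  have h : (Finset.univ : Finset Tile) =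
    {.T0, .T1, .T2, .T3, .T4, .T5, .T6, .T7, .T8, .T9, .T10} := rfl
  rw [h]
  repeat rw [Finset.sum_insert (by decide)]
  rw [Finset.sum_singleton]

/-- The block recursion peels off the bottom tile, whose left and right edges are the leading digits
and select the block. The coefficient 4 comes from `T7`, ..., `T10`. -/
theorem stateMatrix_prependBit {n : ℕ} (b b' x y : Bool) (i j : Fin (2 ^ n)) :
    stateMatrix (n + 1) b b' (prependBit x i) (prependBit y j) =
      ∑ t : Tile, if t.left = x ∧ t.right = y ∧ t.bottom = b then stateMatrix n t.top b' i j
        else 0 := by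
  rw [sum_tile]
  cases b <;> cases b' <;> cases x <;> cases y <;>
    simp [stateMatrix, Xplus, Xminus, Oplus, Ominus, blocks, prependBit, Tile.left, Tile.right,
      Tile.top, Tile.bottom, -zsmul_eq_mul] <;> ring

open Classical in
/-- The entries of the state matrices count the columns with prescribed edge states. -/
theorem stateMatrix_apply {n : ℕ} (b b' : Bool) (i j : Fin (2 ^ n)) :
    stateMatrix n b b' i j = ∑ c : Fin n → Tile,
      if (∀ r : Fin n, (c r).left = (i : ℕ).testBit r ∧ (c r).right = (j : ℕ).testBit r) ∧
        IsChain n b b' c then 1 else 0 := by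
  induction n generalizing b with
  | zero => cases b <;> cases b' <;> simp [stateMatrix, Xplus, Xminus, Oplus, Ominus, IsChain]
  | succ n ih =>
    obtain ⟨x, i, rfl⟩ := exists_prependBit i
    obtain ⟨y, j, rfl⟩ := exists_prependBit j
    rw [stateMatrix_prependBit, ← (Fin.snocEquiv fun _ => Tile).sum_comp, Fintype.sum_prod_type]
    refine Finset.sum_congr rfl fun t _ => ?_
    rw [ih]
    split_ifs with h
    · refine Finset.sum_congr rfl fun c _ => ?_
      refine if_congr ?_ rfl rfl
      simp [Fin.forall_fin_succ', IsChain, testBit_prependBit_last, testBit_prependBit_of_lt, h]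
    · refine (Finset.sum_eq_zero fun c _ => if_neg fun hc => h ?_).symm
      simpa [Fin.forall_fin_succ', IsChain, testBit_prependBit_last, and_assoc] using
        And.intro (hc.1 (Fin.last n)) hc.2.1

-- Twisted traces and twisted columns

theorem testBit_bijective (n : ℕ) :
    Function.Bijective fun (i : Fin (2 ^ n)) (r : Fin n) => (i : ℕ).testBit r := by
  rw [Fintype.bijective_iff_injective_and_card]
  refine ⟨fun i j h => Fin.ext (Nat.eq_of_testBit_eq fun r => ?_), by simp⟩
  rcases lt_or_ge r n with hr | hr
  · exact congrFun h ⟨r, hr⟩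
  · rw [Nat.testBit_lt_two_pow (i.isLt.trans_le (Nat.pow_le_pow_right two_pos hr)),
      Nat.testBit_lt_two_pow (j.isLt.trans_le (Nat.pow_le_pow_right two_pos hr))]

/-- `alpha p k` shifts the binary digits cyclically by `k` places. -/
theorem testBit_alpha {p k : ℕ} (hk : k < p) (i : Fin (2 ^ p)) {r : ℕ} (hr : r < p) :
    (alpha p k i : ℕ).testBit ((r + k) % p) = (i : ℕ).testBit r := by
  have hmod : (r + k) % p < p := Nat.mod_lt _ (by omega)
  unfold alpha
  split_ifs with h
  · rw [h, Nat.testBit_two_pow_sub_one, Nat.testBit_two_pow_sub_one]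
    simp [hr, hmod]
  · obtain ⟨d, rfl⟩ : ∃ d, p = d + k := ⟨p - k, by omega⟩
    have hlo : (i : ℕ) % 2 ^ d < 2 ^ d := Nat.mod_lt _ (by positivity)
    have hhi : (i : ℕ) / 2 ^ d < 2 ^ k :=
      Nat.div_lt_of_lt_mul (by rw [← pow_add]; exact i.isLt)
    have hi := Nat.div_add_mod (i : ℕ) (2 ^ d)
    have hpow : (2 : ℕ) ^ (d + k) = 2 ^ d * 2 ^ k := pow_add _ _ _
    have hlt := i.isLt
    -- With `i = 2^d a + e` and `2^(d+k) ≡ 1`, multiplying by `2^k` moves the top `k` digits `a` to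
    -- the bottom.
    have key : 2 ^ k * (i : ℕ) % (2 ^ (d + k) - 1) =
        2 ^ k * ((i : ℕ) % 2 ^ d) + (i : ℕ) / 2 ^ d := by
      set a := (i : ℕ) / 2 ^ d
      set e := (i : ℕ) % 2 ^ d
      -- Otherwise all digits of `a` and `e` are 1, so `i = 2^p - 1`, the case already split off.
      have hle : 2 ^ k * e + a < 2 ^ (d + k) - 1 := by
        have h1 : 2 ^ k * (e + 1) ≤ 2 ^ k * 2 ^ d := Nat.mul_le_mul_left _ hlo
        rcases Nat.lt_or_ge (2 ^ k * e + a) (2 ^ (d + k) - 1) with h' | h'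
        · exact h'
        · exfalso
          have ha : a = 2 ^ k - 1 := by
            nlinarith [Nat.one_le_two_pow (n := k),
              Nat.sub_add_cancel (Nat.one_le_two_pow (n := k)),
              Nat.sub_add_cancel (Nat.one_le_two_pow (n := d + k))]
          have he : e + 1 = 2 ^ d := by
            refine le_antisymm hlo (Nat.le_of_mul_le_mul_left ?_ (Nat.two_pow_pos k))
            rw [mul_add, mul_one, mul_comm, ← hpow]
            have := Nat.one_le_two_pow (n := k)
            omega
          apply h
          have := Nat.one_le_two_pow (n := k)
          have h2 : 2 ^ d * a + 2 ^ d = 2 ^ (d + k) := by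
            rw [hpow, ha]; nth_rewrite 2 [← mul_one (2 ^ d)]; rw [← mul_add]
            congr 1; omega
          omega
      have : 2 ^ k * (i : ℕ) = 2 ^ k * e + a + (2 ^ (d + k) - 1) * a := by
        rw [Nat.sub_mul, one_mul, ← hi, mul_add, hpow]
        have : a ≤ 2 ^ d * 2 ^ k * a := Nat.le_mul_of_pos_left _ (by positivity)
        have : 2 ^ k * (2 ^ d * a) = 2 ^ d * 2 ^ k * a := by ring
        omega
      rw [this, Nat.add_mul_mod_self_left, Nat.mod_eq_of_lt hle]
    simp only [key]
    rw [Nat.testBit_two_pow_mul_add _ hhi]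
    rcases lt_or_ge r d with hrd | hrd
    · rw [Nat.mod_eq_of_lt (by omega), if_neg (by omega), Nat.add_sub_cancel,
        Nat.testBit_mod_two_pow]
      simp [hrd]
    · have : (r + k) % (d + k) = r - d := by
        rw [Nat.mod_eq_sub_mod (by omega), Nat.mod_eq_of_lt (by omega)]; omega
      rw [this, if_pos (by omega), Nat.testBit_div_two_pow, Nat.sub_add_cancel hrd]

/-- `c` is a column of the period mosaic on the torus `ℤ/n × ℤ/n` that is invariant under the
rotation by `(k, 1)`. -/
def IsTwistedColumn {n : ℕ} (k : ZMod n) (c : ZMod n → Tile) : Prop :=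
  (∀ i, (c i).right = (c (i - k)).left) ∧ ∀ i, (c i).bottom = (c (i + 1)).top

/-- The columns of the period mosaics invariant under the rotation by `(k, 1)`. -/
abbrev TwistedColumn (n : ℕ) (k : ZMod n) : Type := {c : ZMod n → Tile // IsTwistedColumn k c}

theorem isChain_self_iff {n : ℕ} {b : Bool} {c : Fin (n + 1) → Tile} :
    IsChain (n + 1) b b c ↔
      b = (c (Fin.last n)).bottom ∧ ∀ i, (c i).bottom = (c (i + 1)).top := by
  rw [isChain_succ_iff, Fin.forall_fin_succ']
  simp only [Fin.coeSucc_eq_succ, Fin.last_add_one]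
  constructor
  · rintro ⟨rfl, h, h'⟩
    exact ⟨rfl, h', h.symm⟩
  · rintro ⟨rfl, h, h'⟩
    exact ⟨rfl, h'.symm, h⟩

/-- Equal end states close the column vertically, and the shifted digits encode the horizontal
twist. The column determines `i` and `b`, so it is counted once in the twisted trace. -/
theorem column_states_iff {n k : ℕ} (hk : k < n + 1) (i : Fin (2 ^ (n + 1))) (b : Bool)
    (c : Fin (n + 1) → Tile) :
    ((∀ r : Fin (n + 1), (c r).left = (i : ℕ).testBit r ∧
        (c r).right = (alpha (n + 1) k i : ℕ).testBit r) ∧ IsChain (n + 1) b b c) ↔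
      (i = (Equiv.ofBijective _ (testBit_bijective (n + 1))).symm (fun r => (c r).left) ∧
        b = (c (Fin.last n)).bottom) ∧ IsTwistedColumn (n := n + 1) (k : ZMod (n + 1)) c := by
  have hα (r : Fin (n + 1)) : (alpha (n + 1) k i : ℕ).testBit r =
      (i : ℕ).testBit (r - ⟨k, hk⟩ : Fin (n + 1)) := by
    have h : ((r - ⟨k, hk⟩ : Fin (n + 1)) + k : ℕ) % (n + 1) = r := by
      have := Fin.val_add (r - ⟨k, hk⟩) (⟨k, hk⟩ : Fin (n + 1))
      rw [sub_add_cancel] at this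
      exact this.symm
    rw [← testBit_alpha hk i (r - ⟨k, hk⟩ : Fin (n + 1)).isLt, h]
  have hk' : ((k : ZMod (n + 1)) : Fin (n + 1)) = ⟨k, hk⟩ :=
    Fin.ext (ZMod.val_cast_of_lt hk)
  have hcol : IsTwistedColumn (n := n + 1) (k : ZMod (n + 1)) c ↔
      (∀ r : Fin (n + 1), (c r).right = (c (r - ⟨k, hk⟩)).left) ∧
        ∀ r : Fin (n + 1), (c r).bottom = (c (r + 1)).top := by
    rw [← hk']; exact Iff.rfl
  rw [isChain_self_iff, Equiv.eq_symm_apply, hcol, funext_iff]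
  simp only [Equiv.ofBijective_apply, hα, forall_and]
  constructor
  · rintro ⟨⟨h1, h2⟩, h3, h4⟩
    exact ⟨⟨fun r => (h1 r).symm, h3⟩, fun r => (h2 r).trans (h1 _).symm, h4⟩
  · rintro ⟨⟨h1, h3⟩, h2, h4⟩
    exact ⟨⟨fun r => (h1 r).symm, fun r => (h2 r).trans (h1 _).symm⟩, h3, h4⟩

/-- The twisted trace of the state matrices counts the twisted columns. -/
theorem twistedTrace_eq_card {p k : ℕ} (hk : k < p) :
    twistedTrace k (Xplus p + Oplus p) = Nat.card (TwistedColumn p (k : ZMod p)) := by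
  classical
  obtain ⟨n, rfl⟩ : ∃ n, p = n + 1 := ⟨p - 1, by omega⟩
  have hsum (i j : Fin (2 ^ (n + 1))) : (Xplus (n + 1) + Oplus (n + 1)) i j =
      ∑ b, stateMatrix (n + 1) b b i j := by
    rw [Fintype.sum_bool, add_comm]; rfl
  simp only [twistedTrace, hsum, stateMatrix_apply, column_states_iff hk]
  rw [Finset.sum_congr rfl fun i _ => Finset.sum_comm, Finset.sum_comm,
    Nat.card_eq_fintype_card, Fintype.card_subtype, Finset.card_filter, Nat.cast_sum]
  refine Finset.sum_congr rfl fun c _ => ?_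
  rw [← Fintype.sum_prod_type']
  by_cases hc : IsTwistedColumn (n := n + 1) (k : ZMod (n + 1)) c
  · simp only [hc, and_true, ← Prod.ext_iff (x := (_, _)) (y := (_, _)), if_true]
    simp
  · simp [hc]

-- Reflections of tiles

/-- Reflection of a tile in its vertical axis. -/
def Tile.mirror : Tile → Tile
  | T0 => T0 | T1 => T2 | T2 => T1 | T3 => T4 | T4 => T3 | T5 => T5 | T6 => T6
  | T7 => T8 | T8 => T7 | T9 => T10 | T10 => T9

/-- Reflection of a tile in its main diagonal. -/
def Tile.transpose : Tile → Tile
  | T0 => T0 | T1 => T3 | T2 => T2 | T3 => T1 | T4 => T4 | T5 => T6 | T6 => T5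
  | T7 => T7 | T8 => T8 | T9 => T9 | T10 => T10

namespace Tile

@[simp] theorem mirror_mirror (t : Tile) : t.mirror.mirror = t := by cases t <;> rfl
@[simp] theorem left_mirror (t : Tile) : t.mirror.left = t.right := by cases t <;> rfl
@[simp] theorem right_mirror (t : Tile) : t.mirror.right = t.left := by cases t <;> rfl
@[simp] theorem top_mirror (t : Tile) : t.mirror.top = t.top := by cases t <;> rfl
@[simp] theorem bottom_mirror (t : Tile) : t.mirror.bottom = t.bottom := by cases t <;> rfl
@[simp] theorem transpose_transpose (t : Tile) : t.transpose.transpose = t := by cases t <;> rfl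
@[simp] theorem left_transpose (t : Tile) : t.transpose.left = t.top := by cases t <;> rfl
@[simp] theorem right_transpose (t : Tile) : t.transpose.right = t.bottom := by cases t <;> rfl
@[simp] theorem top_transpose (t : Tile) : t.transpose.top = t.left := by cases t <;> rfl
@[simp] theorem bottom_transpose (t : Tile) : t.transpose.bottom = t.right := by cases t <;> rfl

end Tile

theorem IsTwistedColumn.mirror {n : ℕ} {k : ZMod n} {c : ZMod n → Tile}
    (h : IsTwistedColumn k c) : IsTwistedColumn (-k) fun i => (c i).mirror := by
  refine ⟨fun i => ?_, fun i => by simpa using h.2 i⟩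
  simpa using (h.1 (i + k)).symm

theorem card_twistedColumn_neg {n : ℕ} (k : ZMod n) :
    Nat.card (TwistedColumn n (-k)) = Nat.card (TwistedColumn n k) :=
  Nat.card_congr
    { toFun := fun c => ⟨fun i => (c.1 i).mirror, by simpa using c.2.mirror⟩
      invFun := fun c => ⟨fun i => (c.1 i).mirror, c.2.mirror⟩
      left_inv := fun c => by simp
      right_inv := fun c => by simp }

-- Translations of the torus and their fixed mosaics

/-- The period mosaics on the torus `ℤ/n × ℤ/n`. -/
abbrev TorusMosaic (n : ℕ) : Type :=
  {M : ZMod n → ZMod n → Tile // (∀ i j, (M i j).right = (M i (j + 1)).left) ∧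
    ∀ i j, (M i j).bottom = (M (i + 1) j).top}

instance (n : ℕ) : AddAction (ZMod n × ZMod n) (TorusMosaic n) where
  vadd g M := ⟨fun i j => M.1 (i - g.1) (j - g.2),
    fun i j => by rw [M.2.1, sub_add_eq_add_sub], fun i j => by rw [M.2.2, sub_add_eq_add_sub]⟩
  zero_vadd M := Subtype.ext (by
    funext i j
    change M.1 (i - 0) (j - 0) = M.1 i j
    rw [sub_zero, sub_zero])
  add_vadd g h M := Subtype.ext (by
    funext i j
    change M.1 (i - (g.1 + h.1)) (j - (g.2 + h.2)) = M.1 (i - g.1 - h.1) (j - g.2 - h.2)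
    rw [sub_sub, sub_sub])

theorem TorusMosaic.vadd_apply {n : ℕ} (g : ZMod n × ZMod n) (M : TorusMosaic n) (i j : ZMod n) :
    (g +ᵥ M).1 i j = M.1 (i - g.1) (j - g.2) := rfl

theorem TorusMosaic.mem_fixedBy {n : ℕ} {g : ZMod n × ZMod n} {M : TorusMosaic n} :
    M ∈ AddAction.fixedBy (TorusMosaic n) g ↔ ∀ i j, M.1 (i - g.1) (j - g.2) = M.1 i j := by
  rw [AddAction.mem_fixedBy, Subtype.ext_iff, funext_iff]
  simp only [funext_iff, vadd_apply]

/-- A mosaic fixed by `g` is fixed by every multiple of `g`. -/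
theorem TorusMosaic.fixedBy_subset_mul {n : ℕ} [NeZero n] (g : ZMod n × ZMod n) (a : ZMod n) :
    AddAction.fixedBy (TorusMosaic n) g ⊆
      AddAction.fixedBy (TorusMosaic n) (a * g.1, a * g.2) := by
  intro M hM
  have : (a * g.1, a * g.2) = a.val • g := by
    ext <;> simp
  rw [this]
  have h : g ∈ AddAction.stabilizer (ZMod n × ZMod n) M := hM
  exact nsmul_mem h _

/-- A mosaic invariant under `(k, 1)` is determined by its first column. -/
def fixedByEquivColumn {n : ℕ} [NeZero n] (k : ZMod n) :
    AddAction.fixedBy (TorusMosaic n) ((k, 1) : ZMod n × ZMod n) ≃ TwistedColumn n k where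
  toFun M := ⟨fun i => M.1.1 i 0, fun i => by
    have h := TorusMosaic.mem_fixedBy.1 M.2 i 1
    rw [M.1.2.1]
    simpa using congrArg Tile.left h.symm, fun i => M.1.2.2 i 0⟩
  invFun c := ⟨⟨fun i j => c.1 (i - k * j),
    fun i j => by simpa only [mul_add, mul_one, sub_sub] using c.2.1 (i - k * j),
    fun i j => by rw [c.2.2, sub_add_eq_add_sub]⟩,
    TorusMosaic.mem_fixedBy.2 fun i j => by
      change c.1 (i - k - k * (j - 1)) = c.1 (i - k * j)
      exact congrArg c.1 (by ring)⟩
  left_inv M := by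
    refine Subtype.ext (Subtype.ext ?_)
    funext i j
    have h := TorusMosaic.mem_fixedBy.1 (TorusMosaic.fixedBy_subset_mul _ j M.2) i j
    simpa [mul_comm j k] using h
  right_inv c := by
    refine Subtype.ext ?_
    funext i
    simp

/-- A mosaic with all rows equal is determined by its first row. -/
def fixedByEquivRow {n : ℕ} [NeZero n] :
    AddAction.fixedBy (TorusMosaic n) ((1, 0) : ZMod n × ZMod n) ≃ TwistedColumn n 0 where
  -- Vertical period 1 makes top and bottom edges agree; transposed, this is the horizontal
  -- condition with twist 0.
  toFun M := ⟨fun j => (M.1.1 0 j).transpose, fun j => by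
    have h := TorusMosaic.mem_fixedBy.1 M.2 1 j
    have h' := M.1.2.2 0 j
    simp only [sub_self, sub_zero, zero_add] at h h'
    simpa using h'.trans (congrArg Tile.top h.symm), fun j => by simpa using M.1.2.1 0 j⟩
  invFun c := ⟨⟨fun _ j => (c.1 j).transpose,
    fun i j => by simpa using c.2.2 j, fun i j => by simpa using c.2.1 j⟩,
    TorusMosaic.mem_fixedBy.2 fun i j => by simp⟩
  left_inv M := by
    refine Subtype.ext (Subtype.ext ?_)
    funext i j
    have h := TorusMosaic.mem_fixedBy.1 (TorusMosaic.fixedBy_subset_mul _ i M.2) i j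
    simpa using h
  right_inv c := by
    refine Subtype.ext ?_
    funext i
    simp

-- Passage to the torus and Burnside's lemma

theorem forall_adjacent_and_ends_iff {n : ℕ} (P : Fin (n + 1) → Fin (n + 1) → Prop) :
    ((∀ j j' : Fin (n + 1), (j : ℕ) + 1 = j' → P j j') ∧
      ∀ j j' : Fin (n + 1), (j : ℕ) + 1 = n + 1 → (j' : ℕ) = 0 → P j j') ↔
      ∀ j, P j (j + 1) := by
  constructor
  · rintro ⟨h1, h2⟩ j
    induction j using Fin.lastCases with
    | last => exact h2 _ _ (by simp) (by simp)
    | cast j => exact h1 _ _ (by simp)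
  · refine fun h => ⟨fun j j' hj => ?_, fun j j' hj hj' => ?_⟩
    · have := h j
      rwa [show j + 1 = j' from Fin.ext (by rw [Fin.val_add_one_of_lt' (by omega), hj])] at this
    · have := h j
      rwa [show j = Fin.last n from Fin.ext (by simpa using hj), Fin.last_add_one,
        ← show j' = 0 from Fin.ext hj', ← show j = Fin.last n from Fin.ext (by simpa using hj)]
        at this

theorem isPeriodic_iff {n : ℕ} (M : Mosaic (n + 1) (n + 1)) :
    SuitablyConnected M ∧ SuitablyBoundaryConnected M ↔
      (∀ i j, (M i j).right = (M i (j + 1)).left) ∧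
        ∀ i j, (M i j).bottom = (M (i + 1) j).top := by
  have h1 (i) := forall_adjacent_and_ends_iff fun j j' => (M i j).right = (M i j').left
  have h2 (j) := forall_adjacent_and_ends_iff fun i i' => (M i j).bottom = (M i' j).top
  rw [forall_comm (p := fun i j => (M i j).bottom = (M (i + 1) j).top)]
  simp only [← h1, ← h2, SuitablyConnected, SuitablyBoundaryConnected, forall_and]
  constructor
  · rintro ⟨⟨a, b⟩, c, d⟩
    exact ⟨⟨a, c⟩, fun j i i' => b i i' j, fun j i i' => d i i' j⟩
  · rintro ⟨⟨a, c⟩, b, d⟩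
    exact ⟨⟨a, fun i i' j => b j i i'⟩, c, fun i i' j => d j i i'⟩

/-- Indexing the rows and columns by `ℤ/n`. -/
def periodMosaicEquiv (n : ℕ) : PeriodMosaic (n + 1) (n + 1) ≃ TorusMosaic (n + 1) where
  toFun M := ⟨M.1, (isPeriodic_iff M.1).1 M.2⟩
  invFun M := ⟨M.1, (isPeriodic_iff M.1).2 M.2⟩
  left_inv _ := rfl
  right_inv _ := rfl

theorem DP_eq_card (n : ℕ) [NeZero n] : DP n n = Nat.card (TorusMosaic n) := by
  obtain ⟨m, rfl⟩ := Nat.exists_eq_succ_of_ne_zero (NeZero.ne n)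
  exact Nat.card_congr (periodMosaicEquiv m)

theorem DT_eq_card (n : ℕ) [NeZero n] :
    DT n n = Nat.card (AddAction.orbitRel.Quotient (ZMod n × ZMod n) (TorusMosaic n)) := by
  obtain ⟨m, rfl⟩ := Nat.exists_eq_succ_of_ne_zero (NeZero.ne n)
  refine Nat.card_congr (Quotient.congr (periodMosaicEquiv m) fun M N => ?_)
  -- `orbitRel` puts its first argument in the orbit of the second, the reverse of `toroidalSetoid`.
  rw [Setoid.comm' (AddAction.orbitRel _ _), AddAction.orbitRel_apply, AddAction.mem_orbit_iff]
  constructor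
  · rintro ⟨x, y, h⟩
    exact ⟨(x, y), Subtype.ext h.symm⟩
  · rintro ⟨⟨x, y⟩, h⟩
    exact ⟨x, y, congrArg Subtype.val h.symm⟩

theorem sum_card_fixedBy (n : ℕ) [NeZero n] :
    ∑ g : ZMod n × ZMod n, Nat.card (AddAction.fixedBy (TorusMosaic n) g) = DT n n * n ^ 2 := by
  classical
  have : Fintype (AddAction.orbitRel.Quotient (ZMod n × ZMod n) (TorusMosaic n)) :=
    Fintype.ofFinite _
  have (g : ZMod n × ZMod n) : Fintype (AddAction.fixedBy (TorusMosaic n) g) :=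
    Fintype.ofFinite _
  have h := AddAction.sum_card_fixedBy_eq_card_orbits_mul_card_addGroup
    (ZMod n × ZMod n) (TorusMosaic n)
  rw [DT_eq_card, Nat.card_eq_fintype_card]
  simp only [Nat.card_eq_fintype_card]
  rw [h, Fintype.card_prod, ZMod.card, sq]

section Prime

variable (p : ℕ) [Fact p.Prime]

/-- `(x, y)` and `(x * y⁻¹, 1)` are multiples of each other, hence fix the same mosaics. -/
theorem card_fixedBy_of_ne_zero (x : ZMod p) {y : ZMod p} (hy : y ≠ 0) :
    Nat.card (AddAction.fixedBy (TorusMosaic p) (x, y)) =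
      Nat.card (TwistedColumn p (x * y⁻¹)) := by
  rw [← Nat.card_congr (fixedByEquivColumn (x * y⁻¹))]
  have : AddAction.fixedBy (TorusMosaic p) (x, y) =
      AddAction.fixedBy (TorusMosaic p) (x * y⁻¹, (1 : ZMod p)) := by
    refine Set.Subset.antisymm ?_ ?_
    · have h := TorusMosaic.fixedBy_subset_mul (x, y) y⁻¹
      rwa [inv_mul_cancel₀ hy, mul_comm] at h
    · have h := TorusMosaic.fixedBy_subset_mul (x * y⁻¹, (1 : ZMod p)) y
      rwa [mul_one, show y * (x * y⁻¹) = x by field_simp] at h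
  rw [this]

theorem card_fixedBy_zero_right {x : ZMod p} (hx : x ≠ 0) :
    Nat.card (AddAction.fixedBy (TorusMosaic p) (x, (0 : ZMod p))) =
      Nat.card (TwistedColumn p 0) := by
  rw [← Nat.card_congr fixedByEquivRow]
  have : AddAction.fixedBy (TorusMosaic p) (x, (0 : ZMod p)) =
      AddAction.fixedBy (TorusMosaic p) ((1 : ZMod p), (0 : ZMod p)) := by
    refine Set.Subset.antisymm ?_ ?_
    · have h := TorusMosaic.fixedBy_subset_mul (x, (0 : ZMod p)) x⁻¹
      rwa [inv_mul_cancel₀ hx, mul_zero] at h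
    · have h := TorusMosaic.fixedBy_subset_mul ((1 : ZMod p), (0 : ZMod p)) x
      rwa [mul_one, mul_zero] at h
  rw [this]

theorem DT_mul_sq : DT p p * p ^ 2 = DP p p + (p - 1) *
    (∑ k : ZMod p, Nat.card (TwistedColumn p k) + Nat.card (TwistedColumn p 0)) := by
  have hcard : (Finset.univ.erase (0 : ZMod p)).card = p - 1 := by
    rw [Finset.card_erase_of_mem (Finset.mem_univ _), Finset.card_univ, ZMod.card]
  have h0 : Nat.card (AddAction.fixedBy (TorusMosaic p) ((0 : ZMod p), (0 : ZMod p))) = DP p p := by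
    rw [DP_eq_card, ← Prod.zero_eq_mk, AddAction.fixedBy_zero_eq_univ, Nat.card_univ]
  rw [← sum_card_fixedBy, Fintype.sum_prod_type_right,
    ← Finset.add_sum_erase _ _ (Finset.mem_univ 0), ← Finset.add_sum_erase _ _ (Finset.mem_univ 0),
    h0, Finset.sum_congr rfl fun x hx => card_fixedBy_zero_right p (Finset.ne_of_mem_erase hx),
    Finset.sum_const, hcard]
  have hy : ∀ y ∈ Finset.univ.erase (0 : ZMod p),
      ∑ x : ZMod p, Nat.card (AddAction.fixedBy (TorusMosaic p) (x, y)) =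
        ∑ k : ZMod p, Nat.card (TwistedColumn p k) := by
    intro y hy
    have hy := Finset.ne_of_mem_erase hy
    rw [Finset.sum_congr rfl fun x _ => card_fixedBy_of_ne_zero p x hy]
    -- For fixed `y ≠ 0` the slope `x * y⁻¹` runs over all residues.
    exact Equiv.sum_comp (Equiv.mulRight₀ y⁻¹ (inv_ne_zero hy))
      fun k => Nat.card (TwistedColumn p k)
  rw [Finset.sum_congr rfl hy, Finset.sum_const, hcard, smul_eq_mul, smul_eq_mul]
  ring

end Prime

theorem sum_zmod_eq_sum_range {n : ℕ} [NeZero n] {R : Type*} [AddCommMonoid R] (f : ZMod n → R) :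
    ∑ k, f k = ∑ k ∈ Finset.range n, f (k : ℕ) := by
  refine (Finset.sum_nbij' (fun k : ℕ => (k : ZMod n)) ZMod.val ?_ ?_ ?_ ?_ ?_).symm
  · simp
  · simp [ZMod.val_lt]
  · intro k hk
    exact ZMod.val_cast_of_lt (Finset.mem_range.1 hk)
  · simp
  · simp

/-- An even function on `ℤ/n`, `n` odd, is summed up by half of the residues. -/
theorem sum_zmod_add_zero_of_even {m : ℕ} {R : Type*} [CommSemiring R] (f : ZMod (2 * m + 1) → R)
    (hf : ∀ k, f (-k) = f k) :
    ∑ k, f k + f 0 = 2 * ∑ k ∈ Finset.range (m + 1), f (k : ℕ) := by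
  have h1 : ∑ k ∈ Finset.range m, f ((m + 1 + k : ℕ)) =
      ∑ k ∈ Finset.range m, f ((k + 1 : ℕ)) := by
    rw [← Finset.sum_range_reflect]
    refine Finset.sum_congr rfl fun k hk => ?_
    rw [← hf]
    congr 1
    rw [neg_eq_iff_add_eq_zero, ← Nat.cast_add, ← ZMod.natCast_self (2 * m + 1)]
    congr 1
    have := Finset.mem_range.1 hk
    omega
  have h2 (g : ℕ → R) : ∑ k ∈ Finset.range (2 * m + 1), g k =
      ∑ k ∈ Finset.range (m + 1), g k + ∑ k ∈ Finset.range m, g (m + 1 + k) := by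
    rw [show 2 * m + 1 = (m + 1) + m by ring, Finset.sum_range_add]
  have h3 : ∑ k ∈ Finset.range m, f ((k + 1 : ℕ)) + f 0 =
      ∑ k ∈ Finset.range (m + 1), f (k : ℕ) := by
    rw [Finset.sum_range_succ', Nat.cast_zero]
  rw [sum_zmod_eq_sum_range, h2 fun k => f k, h1, add_assoc, h3, ← two_mul]

-- Positivity

/-- The tiles that match themselves in both directions. -/
abbrev ConstTile : Type := {t : Tile // t.right = t.left ∧ t.bottom = t.top}

theorem card_constTile : Fintype.card ConstTile = 7 := by decide

/-- Besides the 7 constant columns there is one with a single `T8` among `T7`s: tiles with all four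
connection points always match. -/
theorem seven_lt_card_twistedColumn {n : ℕ} (hn : 1 < n) (k : ZMod n) :
    7 < Nat.card (TwistedColumn n k) := by
  classical
  have : NeZero n := ⟨by omega⟩
  have : Fact (1 < n) := ⟨hn⟩
  let f : Option ConstTile → TwistedColumn n k := fun o => o.elim
    ⟨fun i => if i = 0 then .T8 else .T7, fun i => by dsimp only; split_ifs <;> rfl,
      fun i => by dsimp only; split_ifs <;> rfl⟩
    fun t => ⟨fun _ => t, fun _ => t.2.1, fun _ => t.2.2⟩
  have hne (t : ConstTile) : f none ≠ f (some t) := by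
    intro h
    have h0 : Tile.T8 = t := by simpa [f] using congrFun (congrArg Subtype.val h) 0
    have h1 : Tile.T7 = t := by simpa [f] using congrFun (congrArg Subtype.val h) 1
    exact absurd (h0.trans h1.symm) (by decide)
  have hf : Function.Injective f := by
    rintro (_ | s) (_ | t) h
    · rfl
    · exact absurd h (hne t)
    · exact absurd h.symm (hne s)
    · exact congrArg some (Subtype.ext (congrFun (congrArg Subtype.val h) 0))
  have h := Nat.card_le_card_of_injective f hf
  rw [Nat.card_eq_fintype_card (α := Option _), Fintype.card_option, card_constTile] at h
  omega

/-- The generators of the subgroups of order `p` of `ℤ/p × ℤ/p`. -/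
def direction {p : ℕ} : Option (ZMod p) → ZMod p × ZMod p
  | none => (1, 0)
  | some k => (k, 1)

section Prime

variable {p : ℕ} [Fact p.Prime]

theorem card_fixedBy_direction (o : Option (ZMod p)) :
    Nat.card (AddAction.fixedBy (TorusMosaic p) (direction o)) =
      Nat.card (TwistedColumn p (o.getD 0)) := by
  cases o with
  | none => exact Nat.card_congr fixedByEquivRow
  | some k => exact Nat.card_congr (fixedByEquivColumn k)

theorem mul_sub_mul_ne_zero_of_direction_ne {o o' : Option (ZMod p)} (h : o ≠ o') :
    (direction o).1 * (direction o').2 - (direction o').1 * (direction o).2 ≠ 0 := by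
  rcases o with _ | k <;> rcases o' with _ | k' <;> simp_all [direction, sub_eq_zero]

/-- A mosaic invariant in two directions is constant. -/
theorem eq_of_mem_fixedBy_direction {o o' : Option (ZMod p)} (ho : o ≠ o') {M : TorusMosaic p}
    (h : M ∈ AddAction.fixedBy (TorusMosaic p) (direction o))
    (h' : M ∈ AddAction.fixedBy (TorusMosaic p) (direction o')) (i j : ZMod p) :
    M.1 i j = M.1 0 0 := by
  have hd := mul_sub_mul_ne_zero_of_direction_ne ho
  set g := direction o
  set g' := direction o'
  set d := g.1 * g'.2 - g'.1 * g.2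
  -- Cramer's rule: these are the coefficients of `(i, j)` in the basis `g`, `g'`.
  have h1 := TorusMosaic.fixedBy_subset_mul g ((i * g'.2 - j * g'.1) / d) h
  have h2 := TorusMosaic.fixedBy_subset_mul g' ((j * g.1 - i * g.2) / d) h'
  rw [TorusMosaic.mem_fixedBy] at h1 h2
  rw [← h1, ← h2]
  refine congrArg₂ M.1 ?_ ?_
  · field_simp
    ring
  · field_simp
    ring

theorem card_isConst : Nat.card {M : TorusMosaic p // ∀ i j, M.1 i j = M.1 0 0} = 7 := by
  rw [← card_constTile, ← Nat.card_eq_fintype_card]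
  refine Nat.card_congr
    { toFun := fun M => ⟨M.1.1 0 0, ?_, ?_⟩
      invFun := fun t => ⟨⟨fun _ _ => t, fun _ _ => t.2.1, fun _ _ => t.2.2⟩, fun _ _ => rfl⟩
      left_inv := fun M => Subtype.ext (Subtype.ext ?_)
      right_inv := fun t => rfl }
  · rw [M.1.2.1, M.2]
  · rw [M.1.2.2, M.2]
  · funext i j
    exact (M.2 i j).symm

-- The fixed sets of the `p + 1` directions meet pairwise only in the 7 constants, so their union
-- has `∑ N_k + N_0 - 7p` elements; the mosaic `W` lies outside it.
variable (p) in
theorem sum_card_twistedColumn_lt :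
    ∑ k : ZMod p, Nat.card (TwistedColumn p k) + Nat.card (TwistedColumn p 0) <
      DP p p + 7 * p := by
  classical
  let C : Finset (TorusMosaic p) := {M | ∀ i j, M.1 i j = M.1 0 0}
  let A (o : Option (ZMod p)) : Finset (TorusMosaic p) :=
    {M | M ∈ AddAction.fixedBy (TorusMosaic p) (direction o)}
  have hC : C.card = 7 := by
    rw [← card_isConst (p := p), Nat.card_eq_fintype_card, Fintype.card_subtype]
  have hA (o) : (A o).card = Nat.card (TwistedColumn p (o.getD 0)) := by
    rw [← card_fixedBy_direction, Nat.card_eq_fintype_card, Fintype.card_subtype]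
  have hCA (o) : C ⊆ A o := by
    intro M hM
    simp only [C, A, Finset.mem_filter_univ, TorusMosaic.mem_fixedBy] at hM ⊢
    intro i j
    rw [hM, hM i j]
  have hAC (o) : (A o \ C).card + 7 = Nat.card (TwistedColumn p (o.getD 0)) := by
    rw [← hC, Finset.card_sdiff_add_card_eq_card (hCA o), hA]
  have hdisj : (Finset.univ : Finset (Option (ZMod p))).card = p + 1 ∧
      ((Finset.univ.biUnion fun o => A o \ C).card = ∑ o, (A o \ C).card) := by
    refine ⟨by simp [ZMod.card], Finset.card_biUnion fun o _ o' _ ho => ?_⟩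
    refine Finset.disjoint_left.2 ?_
    intro M hM hM'
    simp only [A, C, Finset.mem_sdiff, Finset.mem_filter_univ] at hM hM'
    exact hM.2 (eq_of_mem_fixedBy_direction ho hM.1 hM'.1)
  let W : TorusMosaic p := ⟨fun i j => if i = 0 ∧ j = 0 then .T8 else .T7,
    fun i j => by dsimp only; split_ifs <;> rfl, fun i j => by dsimp only; split_ifs <;> rfl⟩
  have hW (o) : W ∉ A o := by
    intro h
    simp only [A, Finset.mem_filter_univ, TorusMosaic.mem_fixedBy] at h
    -- This compares the `T8` at the origin with the `T7` at the nonzero position `direction o`.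
    have h := h (direction o).1 (direction o).2
    cases o <;> simp [W, direction] at h
  have hlt : ((Finset.univ.biUnion fun o => A o \ C) ∪ C).card < DP p p := by
    rw [DP_eq_card, Nat.card_eq_fintype_card]
    refine Finset.card_lt_univ_of_notMem (x := W) fun h => ?_
    rcases Finset.mem_union.1 h with h | h
    · obtain ⟨o, -, h⟩ := Finset.mem_biUnion.1 h
      exact hW o (Finset.mem_sdiff.1 h).1
    · exact hW none (hCA none h)
  rw [Finset.card_union_of_disjoint (by
    rw [Finset.disjoint_biUnion_left]
    exact fun o _ => Finset.sdiff_disjoint), hdisj.2, hC] at hlt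
  have hsum := Finset.sum_congr rfl fun o (_ : o ∈ Finset.univ) => hAC o
  rw [Finset.sum_add_distrib, Finset.sum_const, hdisj.1, smul_eq_mul] at hsum
  have hsplit : ∑ o : Option (ZMod p), Nat.card (TwistedColumn p (o.getD 0)) =
      Nat.card (TwistedColumn p 0) + ∑ k : ZMod p, Nat.card (TwistedColumn p k) :=
    Fintype.sum_option _
  omega

end Prime

-- The case `p = 2`, by enumeration

theorem card_twistedColumn_two (k : ZMod 2) :
    Nat.card (TwistedColumn 2 k) = if k = 0 then 29 else 23 := by
  have e := Nat.card_congr ((finTwoArrowEquiv Tile).subtypeEquiv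
    (p := fun c => IsTwistedColumn (n := 2) k c)
    (q := fun c : Tile × Tile => (c.1.right = (if k = 0 then c.1.left else c.2.left) ∧
      c.2.right = if k = 0 then c.2.left else c.1.left) ∧
      c.1.bottom = c.2.top ∧ c.2.bottom = c.1.top) fun c => by
        revert k
        refine Fin.forall_fin_two.2 ⟨?_, ?_⟩ <;>
          exact and_congr Fin.forall_fin_two Fin.forall_fin_two)
  refine e.trans ?_
  rw [Nat.card_eq_fintype_card]
  clear e
  revert k
  decide +kernel

theorem DP_two_two : DP 2 2 = 359 := by
  have e := Nat.card_congr (((Equiv.arrowCongr (Equiv.refl (Fin 2)) (finTwoArrowEquiv Tile)).trans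
    (finTwoArrowEquiv (Tile × Tile))).subtypeEquiv
    (p := fun M : ZMod 2 → ZMod 2 → Tile => (∀ i j, (M i j).right = (M i (j + 1)).left) ∧
      ∀ i j, (M i j).bottom = (M (i + 1) j).top)
    (q := fun M : (Tile × Tile) × Tile × Tile =>
      ((M.1.1.right = M.1.2.left ∧ M.1.2.right = M.1.1.left) ∧
      M.2.1.right = M.2.2.left ∧ M.2.2.right = M.2.1.left) ∧
      (M.1.1.bottom = M.2.1.top ∧ M.1.2.bottom = M.2.2.top) ∧
      M.2.1.bottom = M.1.1.top ∧ M.2.2.bottom = M.1.2.top) fun M =>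
        and_congr
          (Fin.forall_fin_two.trans (and_congr Fin.forall_fin_two Fin.forall_fin_two))
          (Fin.forall_fin_two.trans (and_congr Fin.forall_fin_two Fin.forall_fin_two)))
  rw [DP_eq_card]
  refine e.trans ?_
  rw [Nat.card_eq_fintype_card]
  decide +kernel

theorem DT_two_two : DT 2 2 = 110 := by
  have h := DT_mul_sq 2
  -- Burnside's count is `359 + (29 + 23) + 29 = 4 * 110`.
  simp only [card_twistedColumn_two, DP_two_two] at h
  have hs : ∑ k : ZMod 2, (if k = 0 then 29 else 23) = 52 := by decide
  rw [hs] at h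
  norm_num at h
  omega

end KnotMosaic

theorem theorem4 :
    KnotMosaic.DT 2 2 = 110 ∧
    ∀ (p : ℕ) [Fact p.Prime], 3 ≤ p →
      (∀ k ∈ Finset.range ((p - 1) / 2 + 1), 0 < KnotMosaic.dTwisted p k) ∧
      0 < KnotMosaic.dSquare p ∧
      (KnotMosaic.DT p p : ℚ) =
        1 / (p : ℚ) ^ 2 * (KnotMosaic.dSquare p : ℚ) +
          2 / (p : ℚ) *
            ∑ k ∈ Finset.range ((p - 1) / 2 + 1), (KnotMosaic.dTwisted p k : ℚ) + 7 := by
  refine ⟨KnotMosaic.DT_two_two, fun p hp hp3 => ?_⟩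
  have hcol : ∀ k ∈ Finset.range ((p - 1) / 2 + 1), KnotMosaic.dTwisted p k =
      (Nat.card (KnotMosaic.TwistedColumn p (k : ZMod p)) : ℤ) - 7 := by
    intro k hk
    have := Finset.mem_range.1 hk
    rw [KnotMosaic.dTwisted, KnotMosaic.twistedTrace_eq_card (by omega)]
  have hsum : ∑ k : ZMod p, (Nat.card (KnotMosaic.TwistedColumn p k) : ℤ) +
      Nat.card (KnotMosaic.TwistedColumn p 0) =
        2 * ∑ k ∈ Finset.range ((p - 1) / 2 + 1), KnotMosaic.dTwisted p k + 7 * (p + 1) := by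
    obtain ⟨m, hm⟩ := hp.out.odd_of_ne_two (by omega)
    subst hm
    have h := KnotMosaic.sum_zmod_add_zero_of_even
      (fun k : ZMod (2 * m + 1) => Nat.card (KnotMosaic.TwistedColumn (2 * m + 1) k))
      KnotMosaic.card_twistedColumn_neg
    have hm : (2 * m + 1 - 1) / 2 + 1 = m + 1 := by omega
    rw [Finset.sum_congr rfl hcol, hm, Finset.sum_sub_distrib, Finset.sum_const, Finset.card_range]
    zify at h
    rw [h]
    simp only [nsmul_eq_mul]
    push_cast
    ring
  have hlt := KnotMosaic.sum_card_twistedColumn_lt p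
  have hDT := KnotMosaic.DT_mul_sq p
  zify [hp.out.one_le] at hlt hDT
  rw [hsum] at hlt hDT
  refine ⟨fun k hk => ?_, ?_, ?_⟩
  · have := KnotMosaic.seven_lt_card_twistedColumn hp.out.one_lt (k : ZMod p)
    rw [hcol k hk]
    omega
  · rw [KnotMosaic.dSquare]
    -- `d_{p²}` equals `D_P + 7p - (∑ N_k + N_0)`, positive by `hlt`.
    linarith
  · have hp0 : (p : ℚ) ≠ 0 := Nat.cast_ne_zero.2 hp.out.ne_zero
    have hDT : (KnotMosaic.DT p p * p ^ 2 : ℚ) = KnotMosaic.DP p p + (p - 1) *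
        (2 * ∑ k ∈ Finset.range ((p - 1) / 2 + 1), (KnotMosaic.dTwisted p k : ℚ) +
          7 * (p + 1)) := by
      exact_mod_cast hDT
    rw [KnotMosaic.dSquare]
    push_cast
    field_simp
    linear_combination hDT
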